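/- Let $(\Omega,\mathcal F,P)$ be a probability space, let $N\ge 1$, and write $L^\infty=L^\infty(\Omega,\mathcal F,P)$. Let $U:\mathbb R^N\to\mathbb R$ be nondecreasing with respect to the componentwise order, differentiable, strictly concave on all of $\mathbb R^N$, and such that $\sup\{U(\mathbf y)\mid \mathbf y\in\mathbb R^N\}>0$. Assume moreover that for some $y\in\mathbb R$ the supremum $$\sup\Big\{U(\mathbf x)\;\Big|\;\mathbf x\in\mathbb R^N,\ \sum_{i=1}^N x^i=y\Big\}$$ is attained, i.e. there is $\mathbf x\in\mathbb R^N$ with $\sum_{i=1}^N x^i=y$ at which $U(\mathbf x)$ equals this supremum. For $\mathbf X\in(L^\infty)^N$ define $$\rho(\mathbf X):=\inf\Big\{\sum_{i=1}^N Y^i\;\Big|\;\mathbf Y\in(L^\infty)^N,\ \sum_{i=1}^N Y^i\in\mathbb R,\ \mathbb E[U(\mathbf X+\mathbf Y)]\ge 0\Big\}\in[-\infty,+\infty],$$ where $\inf\emptyset=+\infty$ and $\sum_{i=1}^N Y^i\in\mathbb R$ means that the sum is $P$-a.s. equal to a deterministic constant. Then $\rho$ is finite valued, i.e. $\rho(\mathbf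 X)\in\mathbb R$ for every $\mathbf X\in(L^\infty)^N$, and law invariant, i.e. $\rho(\mathbf X)=\rho(\mathbf Y)$ whenever $\mathbf X,\mathbf Y\in(L^\infty)^N$ have the same law on $\mathbb R^N$ under $P$. -/

import Mathlib

open MeasureTheory Set
open scoped ENNReal

namespace SystemicRisk

/-- The space `(L^∞(Ω, 𝓕, P))^N` of bounded random vectors (up to `P`-a.s. equality). -/
abbrev LInftyVec {Ω : Type*} [MeasurableSpace Ω] (P : Measure Ω) (N : ℕ) : Type _ :=
  Fin N → Lp ℝ ∞ P

/-- The random vector `ω ↦ (X^1(ω), …, X^N(ω))` in `ℝ^N` given by (representatives of) the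
components of `X`. -/
noncomputable def randomVector {Ω : Type*} [MeasurableSpace Ω] {P : Measure Ω} {N : ℕ}
    (X : LInftyVec P N) : Ω → (Fin N → ℝ) :=
  fun ω i => X i ω

/-- The law `P_X` of the random vector `X`, a measure on `ℝ^N`. -/
noncomputable def law {Ω : Type*} [MeasurableSpace Ω] {P : Measure Ω} {N : ℕ}
    (X : LInftyVec P N) : Measure (Fin N → ℝ) :=
  P.map (randomVector X)

/-- The expected utility `𝔼[U(X)]`. For a finite concave `U` on `ℝ^N` (hence continuous) and bounded
`X`, the random variable `U(X)` is bounded, so this is a genuine integral. -/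
noncomputable def expectedUtility {Ω : Type*} [MeasurableSpace Ω] {P : Measure Ω} {N : ℕ}
    (U : (Fin N → ℝ) → ℝ) (X : LInftyVec P N) : ℝ :=
  ∫ ω, U (randomVector X ω) ∂P

/-- The sup-convolution of `U` under the summation map `x ↦ ∑ i, x i`, i.e.
`y ↦ sup {U(x) | x ∈ ℝ^N, ∑ i, x i = y}`, with values in `[-∞, +∞]`. -/
noncomputable def supConv {N : ℕ} (U : (Fin N → ℝ) → ℝ) (y : ℝ) : EReal :=
  sSup {u : EReal | ∃ x : Fin N → ℝ, ∑ i, x i = y ∧ u = (U x : EReal)}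

/-- For some `y ∈ ℝ` the supremum defining the sup-convolution of `U` at `y` is attained. -/
def SupConvAttained {N : ℕ} (U : (Fin N → ℝ) → ℝ) : Prop :=
  ∃ y : ℝ, ∃ x : Fin N → ℝ, ∑ i, x i = y ∧ supConv U y = (U x : EReal)

/-- The systemic shortfall risk measure
`ρ(X) = inf {∑ i, Y i | Y ∈ (L^∞)^N, ∑ i, Y i ∈ ℝ, 𝔼[U(X + Y)] ≥ 0}` with values in `[-∞, +∞]`
(so that `inf ∅ = +∞`); `∑ i, Y i ∈ ℝ` means that the sum is a.s. equal to a constant. -/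
noncomputable def rho {Ω : Type*} [MeasurableSpace Ω] (P : Measure Ω) [IsProbabilityMeasure P]
    {N : ℕ} (U : (Fin N → ℝ) → ℝ) (X : LInftyVec P N) : EReal :=
  sInf {a : EReal | ∃ (Y : LInftyVec P N) (c : ℝ),
    ∑ i, Y i = Lp.const ∞ P c ∧ 0 ≤ expectedUtility U (X + Y) ∧ a = (c : EReal)}

/-- A functional on `(L^∞)^N` is finite valued if it takes only real values. -/
def FiniteValued {Ω : Type*} [MeasurableSpace Ω] {P : Measure Ω} {N : ℕ}
    (r : LInftyVec P N → EReal) : Prop :=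
  ∀ X : LInftyVec P N, ∃ c : ℝ, r X = (c : EReal)

/-- A functional on `(L^∞)^N` is law invariant if it takes the same value on any two random vectors
with the same (joint) law on `ℝ^N`. -/
def LawInvariant {Ω : Type*} [MeasurableSpace Ω] {P : Measure Ω} {N : ℕ}
    (r : LInftyVec P N → EReal) : Prop :=
  ∀ X Y : LInftyVec P N, law X = law Y → r X = r Y

end SystemicRisk

namespace SystemicRisk

section Utility

variable {N : ℕ} {U : (Fin N → ℝ) → ℝ}

/-! Finiteness: at a maximizer of `U` on a hyperplane of constant sum, the gradient kills all
directions of zero sum, so the tangent plane depends on the sum alone and concavity gives `U v ≤ a +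
b * ∑ i, v i` (`exists_le_add_mul_sum`). Since `b > 0`, integrating this bounds every admissible
total from below; a large deterministic allocation bounds `rho` from above.

Law invariance: replacing an allocation `Y` by `E[Y | X] = h(X)` keeps the total, and by Jensen does
not lower expected utility. The same `h` then serves every vector with the law of `X`. -/

/-- The gradient inequality for a concave function. -/
theorem le_add_fderiv_of_concaveOn {E : Type*} [NormedAddCommGroup E] [NormedSpace ℝ E]
    {f : E → ℝ} (hf : ConcaveOn ℝ univ f) {x : E} (hfx : DifferentiableAt ℝ f x) (y : E) :
    f y ≤ f x + fderiv ℝ f x (y - x) := by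
  have hconc : ConcaveOn ℝ univ (f ∘ AffineMap.lineMap (k := ℝ) x y) := by
    simpa using hf.comp_affineMap (AffineMap.lineMap (k := ℝ) x y)
  have hderiv : HasDerivAt (f ∘ AffineMap.lineMap (k := ℝ) x y) (fderiv ℝ f x (y - x)) 0 := by
    refine HasFDerivAt.comp_hasDerivAt (0 : ℝ) ?_ AffineMap.hasDerivAt_lineMap
    simpa using hfx.hasFDerivAt
  have := hconc.slope_le_of_hasDerivAt (mem_univ 0) (mem_univ 1) one_pos hderiv
  simp only [slope_def_field, Function.comp_apply, AffineMap.lineMap_apply_one,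
    AffineMap.lineMap_apply_zero, sub_zero, div_one] at this
  linarith

theorem le_of_supConv_eq {x : Fin N → ℝ} (hx : supConv U (∑ i, x i) = (U x : EReal))
    {v : Fin N → ℝ} (hv : ∑ i, v i = ∑ i, x i) : U v ≤ U x := by
  have : (U v : EReal) ≤ supConv U (∑ i, x i) := le_sSup ⟨v, hv, rfl⟩
  rw [hx] at this
  exact_mod_cast this

/-- At a maximizer of `U` under a constraint on the sum of the coordinates, the derivative of `U`
is a multiple of the summation map. -/
theorem fderiv_eq_mul_sum (hN : 1 ≤ N) {x : Fin N → ℝ} (hU : DifferentiableAt ℝ U x)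
    (hx : supConv U (∑ i, x i) = (U x : EReal)) (v : Fin N → ℝ) :
    fderiv ℝ U x v = fderiv ℝ U x 1 / N * ∑ i, v i := by
  have hN' : (N : ℝ) ≠ 0 := by positivity
  have hzero : ∀ w : Fin N → ℝ, ∑ i, w i = 0 → fderiv ℝ U x w = 0 := by
    intro w hw
    have hderiv : HasDerivAt (fun t : ℝ => U (x + t • w)) (fderiv ℝ U x w) 0 := by
      refine HasFDerivAt.comp_hasDerivAt (f := fun t : ℝ => x + t • w) (0 : ℝ) ?_ ?_
      · simpa using hU.hasFDerivAt
      · simpa using ((hasDerivAt_id (0 : ℝ)).smul_const w).const_add x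
    refine IsLocalMax.hasDerivAt_eq_zero (Filter.Eventually.of_forall fun t => ?_) hderiv
    simp only [zero_smul, add_zero]
    refine le_of_supConv_eq hx ?_
    simp [Finset.sum_add_distrib, ← Finset.mul_sum, hw]
  -- Removing the mean of `v` from each coordinate leaves a vector of zero sum.
  have h := hzero (v - ((∑ i, v i) / N) • 1) (by simp [Finset.sum_sub_distrib]; field_simp; simp)
  rw [map_sub, map_smul, smul_eq_mul, sub_eq_zero] at h
  rw [h]
  ring

/-- `U` lies below an affine function of the sum of the coordinates with positive slope. -/
theorem exists_le_add_mul_sum (hN : 1 ≤ N) (hU_mono : Monotone U) (hU_diff : Differentiable ℝ U)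
    (hU_conc : StrictConcaveOn ℝ univ U) (hU_opt : SupConvAttained U) :
    ∃ a b : ℝ, 0 < b ∧ ∀ v, U v ≤ a + b * ∑ i, v i := by
  obtain ⟨_, x, rfl, hx⟩ := hU_opt
  set b := fderiv ℝ U x 1 / N with hb
  have hle : ∀ v, U v ≤ U x + b * ∑ i, (v - x) i := fun v => by
    rw [hb, ← fderiv_eq_mul_sum hN (hU_diff x) hx]
    exact le_add_fderiv_of_concaveOn hU_conc.concaveOn (hU_diff x) v
  have hlt : U x < U (x + 1) := by
    have hne : x ≠ x + 1 := fun h => by simpa using congrFun h ⟨0, hN⟩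
    have h1 := hU_conc.2 (mem_univ x) (mem_univ (x + 1)) hne
      (one_half_pos (α := ℝ)) (one_half_pos (α := ℝ)) (add_halves 1)
    have h2 := hU_mono (show x ≤ x + 1 from fun i => by simp)
    -- If `U` did not increase from `x` to `x + 1`, strict concavity would put the midpoint strictly
    -- above both endpoint values, although it lies below `x + 1` in the order.
    by_contra hcon
    have heq : U (x + 1) = U x := le_antisymm (not_lt.1 hcon) h2
    have h3 : (1 / 2 : ℝ) • x + (1 / 2 : ℝ) • (x + 1) ≤ x + 1 := fun i => by
      simp; linarith
    have h4 := hU_mono h3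
    simp only [smul_eq_mul, heq] at h1 h4
    linarith
  have hbpos : 0 < b := by
    have h := hle (x + 1)
    simp only [add_sub_cancel_left, Pi.one_apply, Finset.sum_const, Finset.card_univ,
      Fintype.card_fin, nsmul_eq_mul, mul_one] at h
    have : 0 < b * N := by linarith
    exact pos_of_mul_pos_left this (Nat.cast_nonneg N)
  refine ⟨U x - b * ∑ i, x i, b, hbpos, fun v => (hle v).trans_eq ?_⟩
  simp only [Pi.sub_apply, Finset.sum_sub_distrib]
  ring

end Utility

section RandomVectors

variable {Ω : Type*} [MeasurableSpace Ω] {P : Measure Ω} {N : ℕ}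

theorem stronglyMeasurable_randomVector (X : LInftyVec P N) :
    StronglyMeasurable (randomVector X) :=
  (measurable_pi_lambda _ fun i => (Lp.stronglyMeasurable (X i)).measurable).stronglyMeasurable

theorem exists_ae_norm_randomVector_le (X : LInftyVec P N) :
    ∃ R : ℝ, ∀ᵐ ω ∂P, ‖randomVector X ω‖ ≤ R := by
  have h : ∀ i, ∃ R : ℝ, ∀ᵐ ω ∂P, ‖X i ω‖ ≤ R := fun i =>
    ⟨_, ae_le_lpNorm_exponent_top (Lp.memLp (X i))⟩
  choose R hR using h
  refine ⟨∑ i, |R i|, ?_⟩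
  filter_upwards [ae_all_iff.2 hR] with ω hω
  refine (pi_norm_le_iff_of_nonneg (Finset.sum_nonneg fun i _ => abs_nonneg _)).2 fun i => ?_
  exact ((hω i).trans (le_abs_self _)).trans
    (Finset.single_le_sum (f := fun i => |R i|) (fun i _ => abs_nonneg _) (Finset.mem_univ i))

theorem randomVector_add (X Y : LInftyVec P N) :
    randomVector (X + Y) =ᵐ[P] randomVector X + randomVector Y := by
  filter_upwards [ae_all_iff.2 fun i => Lp.coeFn_add (X i) (Y i)] with ω hω
  exact funext hω

theorem integrable_continuous_comp [IsFiniteMeasure P] {U : (Fin N → ℝ) → ℝ} (hU : Continuous U)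
    {f : Ω → Fin N → ℝ} (hf : AEStronglyMeasurable f P) {R : ℝ} (hR : ∀ᵐ ω ∂P, ‖f ω‖ ≤ R) :
    Integrable (U ∘ f) P := by
  obtain ⟨C, hC⟩ := (isCompact_closedBall (0 : Fin N → ℝ) R).exists_bound_of_continuousOn
    hU.continuousOn
  refine Integrable.of_bound (hU.comp_aestronglyMeasurable hf) C ?_
  filter_upwards [hR] with ω hω
  exact hC _ (by simpa using hω)

/-- An essentially bounded random vector as an element of `(L^∞)^N`. -/
theorem exists_randomVector_eq [IsFiniteMeasure P] {f : Ω → Fin N → ℝ}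
    (hf : AEStronglyMeasurable f P) {R : ℝ} (hR : ∀ᵐ ω ∂P, ‖f ω‖ ≤ R) :
    ∃ Y : LInftyVec P N, randomVector Y =ᵐ[P] f := by
  have hmem : ∀ i, MemLp (fun ω => f ω i) ∞ P := fun i =>
    memLp_top_of_bound ((continuous_apply i).comp_aestronglyMeasurable hf) R <| by
      filter_upwards [hR] with ω hω using (norm_le_pi_norm (f ω) i).trans hω
  refine ⟨fun i => (hmem i).toLp _, ?_⟩
  filter_upwards [ae_all_iff.2 fun i => (hmem i).coeFn_toLp] with ω hω
  exact funext hω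

theorem sum_eq_const_iff [IsFiniteMeasure P] (Y : LInftyVec P N) (c : ℝ) :
    ∑ i, Y i = Lp.const ∞ P c ↔ ∀ᵐ ω ∂P, ∑ i, randomVector Y ω i = c := by
  have hsum : ⇑(∑ i, Y i) =ᵐ[P] fun ω => ∑ i, randomVector Y ω i := by
    have h := Lp.coeFn_finsetSum Finset.univ Y
    filter_upwards [h] with ω hω
    rw [hω, Finset.sum_apply]
    rfl
  rw [Lp.ext_iff]
  constructor
  · intro h
    filter_upwards [hsum, h, Lp.coeFn_const (p := ∞) (μ := P) c] with ω h1 h2 h3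
    rw [← h1, h2, h3, Function.const_apply]
  · intro h
    filter_upwards [hsum, h, Lp.coeFn_const (p := ∞) (μ := P) c] with ω h1 h2 h3
    rw [h1, h2, h3, Function.const_apply]

theorem expectedUtility_add {U : (Fin N → ℝ) → ℝ} (X : LInftyVec P N) {Y : LInftyVec P N}
    {f : Ω → Fin N → ℝ} (hf : randomVector Y =ᵐ[P] f) :
    expectedUtility U (X + Y) = ∫ ω, U (randomVector X ω + f ω) ∂P := by
  refine integral_congr_ae ?_
  filter_upwards [randomVector_add X Y, hf] with ω h1 h2
  rw [h1, Pi.add_apply, h2]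

end RandomVectors

section RiskMeasure

variable {Ω : Type*} [MeasurableSpace Ω] {P : Measure Ω} [IsProbabilityMeasure P] {N : ℕ}
  {U : (Fin N → ℝ) → ℝ}

/-- If `R` bounds `X`, the deterministic allocation `y + R` makes the total position dominate `y`.
-/
theorem exists_rho_le (hU_mono : Monotone U) {y : Fin N → ℝ} (hy : 0 < U y)
    (X : LInftyVec P N) : ∃ c : ℝ, rho P U X ≤ c := by
  obtain ⟨R, hR⟩ := exists_ae_norm_randomVector_le X
  obtain ⟨Y, hY⟩ := exists_randomVector_eq (P := P) (f := fun _ => y + fun _ => R)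
    aestronglyMeasurable_const (Filter.Eventually.of_forall fun _ => le_rfl)
  refine ⟨∑ i, (y i + R), sInf_le ⟨Y, _, (sum_eq_const_iff Y _).2 ?_, ?_, rfl⟩⟩
  · filter_upwards [hY] with ω hω
    rw [hω]
    rfl
  · rw [expectedUtility_add X hY]
    refine integral_nonneg_of_ae ?_
    filter_upwards [hR] with ω hω
    refine hy.le.trans (hU_mono fun i => ?_)
    have := neg_le_of_abs_le ((norm_le_pi_norm (randomVector X ω) i).trans hω)
    simp only [Pi.add_apply]
    linarith

theorem exists_le_rho (hU : Continuous U) {a b : ℝ} (hb : 0 < b)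
    (hle : ∀ v, U v ≤ a + b * ∑ i, v i) (X : LInftyVec P N) :
    ∃ c : ℝ, (c : EReal) ≤ rho P U X := by
  obtain ⟨R, hR⟩ := exists_ae_norm_randomVector_le X
  -- This is the value of `c` solving `a + b * (N * R + c) = 0`, where `N * R` bounds the sum of the
  -- components of `X`.
  refine ⟨-(a / b) - N * R, le_sInf ?_⟩
  rintro _ ⟨Y, c, hc, hE, rfl⟩
  rw [sum_eq_const_iff] at hc
  obtain ⟨R', hR'⟩ := exists_ae_norm_randomVector_le (X + Y)
  have hint := integrable_continuous_comp hU
    (stronglyMeasurable_randomVector (X + Y)).aestronglyMeasurable hR'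
  have hbound : expectedUtility U (X + Y) ≤ ∫ _, (a + b * (N * R + c)) ∂P := by
    refine integral_mono_ae hint (integrable_const _) ?_
    filter_upwards [hc, hR, randomVector_add X Y] with ω h1 h2 h3
    refine (hle _).trans ?_
    rw [h3]
    simp only [Pi.add_apply, Finset.sum_add_distrib, h1]
    have : ∑ i, randomVector X ω i ≤ ∑ _i : Fin N, R := Finset.sum_le_sum fun i _ =>
      (le_abs_self _).trans ((norm_le_pi_norm (randomVector X ω) i).trans h2)
    simp only [Finset.sum_const, Finset.card_univ, Fintype.card_fin, nsmul_eq_mul] at this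
    gcongr
  simp only [integral_const, probReal_univ, one_smul] at hbound
  have h0 : 0 ≤ a + b * (N * R + c) := hE.trans hbound
  have h1 : 0 ≤ a / b + (N * R + c) := by
    have := div_nonneg h0 hb.le
    rwa [add_div, mul_div_cancel_left₀ _ hb.ne'] at this
  exact_mod_cast (by linarith : -(a / b) - N * R ≤ c)

/-- Conditioning an allocation on `X` keeps it admissible and turns it into a function of `X`. -/
theorem exists_allocation_of_randomVector (hU : ConcaveOn ℝ univ U) (hUc : Continuous U)
    (X Y : LInftyVec P N) {c : ℝ} (hc : ∀ᵐ ω ∂P, ∑ i, randomVector Y ω i = c)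
    (hE : 0 ≤ expectedUtility U (X + Y)) :
    ∃ (h : (Fin N → ℝ) → Fin N → ℝ) (R : ℝ), StronglyMeasurable h ∧
      (∀ᵐ ω ∂P, ‖h (randomVector X ω)‖ ≤ R) ∧ (∀ᵐ ω ∂P, ∑ i, h (randomVector X ω) i = c) ∧
      0 ≤ ∫ ω, U (randomVector X ω + h (randomVector X ω)) ∂P := by
  set x := randomVector X with hx
  set y := randomVector Y with hy
  have hxm : StronglyMeasurable x := stronglyMeasurable_randomVector X
  have hym : StronglyMeasurable y := stronglyMeasurable_randomVector Y
  have hm := hxm.measurable.comap_le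
  obtain ⟨Rx, hRx⟩ := exists_ae_norm_randomVector_le X
  obtain ⟨Ry, hRy⟩ := exists_ae_norm_randomVector_le Y
  have hxi : Integrable x P := Integrable.of_bound hxm.aestronglyMeasurable Rx hRx
  have hyi : Integrable y P := Integrable.of_bound hym.aestronglyMeasurable Ry hRy
  have hxm' : StronglyMeasurable[MeasurableSpace.comap x inferInstance] x :=
    (comap_measurable x).stronglyMeasurable
  -- Doob–Dynkin: a function measurable for the σ-algebra generated by `x` factors through `x`.
  obtain ⟨h, hh, hcond⟩ := (stronglyMeasurable_condExp (μ := P) (f := y)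
    (m := MeasurableSpace.comap x inferInstance)).exists_eq_measurable_comp
  have hbdd : ∀ᵐ ω ∂P, ‖h (x ω)‖ ≤ Ry := by
    have := ae_bdd_norm_condExp_of_ae_bdd_norm
      (m := MeasurableSpace.comap x inferInstance) hRy
    rwa [← hy, hcond] at this
  have hhx : StronglyMeasurable (fun ω => h (x ω)) := hh.comp_measurable hxm.measurable
  have hadd : P[x + y | MeasurableSpace.comap x inferInstance] =ᵐ[P] fun ω => x ω + h (x ω) := by
    filter_upwards [condExp_add hxi hyi (MeasurableSpace.comap x inferInstance)] with ω hω
    rw [hω, Pi.add_apply, condExp_of_stronglyMeasurable hm hxm' hxi, hcond, Function.comp_apply]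
  have hsum_bdd : ∀ᵐ ω ∂P, ‖(x + y) ω‖ ≤ Rx + Ry := by
    filter_upwards [hRx, hRy] with ω h1 h2 using (norm_add_le _ _).trans (add_le_add h1 h2)
  have hUi : Integrable (U ∘ (x + y)) P :=
    integrable_continuous_comp hUc (hxm.add hym).aestronglyMeasurable hsum_bdd
  have hUh : Integrable (fun ω => U (x ω + h (x ω))) P := by
    refine integrable_continuous_comp (R := Rx + Ry) hUc (hxm.add hhx).aestronglyMeasurable ?_
    filter_upwards [hRx, hbdd] with ω h1 h2 using (norm_add_le _ _).trans (add_le_add h1 h2)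
  refine ⟨h, Ry, hh, hbdd, ?_, ?_⟩
  -- Conditional expectation commutes with the linear map `S`, and `S ∘ y` is a.s. constant.
  · let S : (Fin N → ℝ) →L[ℝ] ℝ := ∑ i, ContinuousLinearMap.proj i
    have hS : ∀ v, S v = ∑ i, v i := fun v => by simp [S]
    have hconst : P[S ∘ y | MeasurableSpace.comap x inferInstance] =ᵐ[P] fun _ => c := by
      have hSy : S ∘ y =ᵐ[P] fun _ => c := by
        filter_upwards [hc] with ω hω
        rw [Function.comp_apply, hS, hω]
      exact (condExp_congr_ae hSy).trans (Filter.EventuallyEq.of_eq (condExp_const hm c))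
    filter_upwards [S.comp_condExp_comm hyi (m := MeasurableSpace.comap x inferInstance), hconst]
      with ω h1 h2
    rw [h2] at h1
    rw [← h1, Function.comp_apply, hS, hcond, Function.comp_apply]
  · calc 0 ≤ ∫ ω, (U ∘ (x + y)) ω ∂P := by
          rwa [expectedUtility_add X (Filter.EventuallyEq.refl _ _)] at hE
      _ = ∫ ω, (P[U ∘ (x + y) | MeasurableSpace.comap x inferInstance]) ω ∂P :=
          (integral_condExp hm).symm
      _ ≤ ∫ ω, U (x ω + h (x ω)) ∂P := by
          refine integral_mono_ae integrable_condExp hUh ?_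
          -- Conditional Jensen for the concave `U`.
          filter_upwards [hU.condExp_map_le_of_finiteDimensional hm (hxi.add hyi) hUi, hadd]
            with ω h1 h2
          rwa [Function.comp_apply, h2] at h1

/-- Any total achievable for `X` is achievable through some `h(X)`; boundedness, the sum constraint
and expected utility of `h(X)` depend only on the law of `X`, so `h(X')` achieves the same total. -/
theorem rho_le_of_law_eq (hU : ConcaveOn ℝ univ U) (hUc : Continuous U) {X X' : LInftyVec P N}
    (hlaw : law X = law X') : rho P U X' ≤ rho P U X := by
  refine sInf_le_sInf ?_
  rintro _ ⟨Y, c, hc, hE, rfl⟩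
  rw [sum_eq_const_iff] at hc
  obtain ⟨h, R, hh, hR, hsum, hint⟩ := exists_allocation_of_randomVector hU hUc X Y hc hE
  have hX := (stronglyMeasurable_randomVector X).measurable.aemeasurable (μ := P)
  have hX' := (stronglyMeasurable_randomVector X').measurable.aemeasurable (μ := P)
  have transfer : ∀ {p : (Fin N → ℝ) → Prop}, MeasurableSet {v | p v} →
      (∀ᵐ ω ∂P, p (randomVector X ω)) → ∀ᵐ ω ∂P, p (randomVector X' ω) := by
    intro p hp hae
    rw [← ae_map_iff hX' hp]
    change ∀ᵐ v ∂(law X'), p v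
    rw [← hlaw]
    exact (ae_map_iff hX hp).2 hae
  have hR' := transfer (measurableSet_le hh.norm.measurable measurable_const) hR
  have hsum' := transfer (p := fun v => ∑ i, h v i = c)
    (measurableSet_eq_fun (Finset.measurable_sum _ fun i _ =>
      (measurable_pi_apply i).comp hh.measurable) measurable_const) hsum
  obtain ⟨Y', hY'⟩ := exists_randomVector_eq
    (hh.comp_measurable (stronglyMeasurable_randomVector X').measurable).aestronglyMeasurable hR'
  refine ⟨Y', c, (sum_eq_const_iff Y' c).2 ?_, ?_, rfl⟩
  · filter_upwards [hY', hsum'] with ω h1 h2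
    rw [h1]
    exact h2
  · have hmeas : StronglyMeasurable fun v => U (v + h v) :=
      hUc.comp_stronglyMeasurable (stronglyMeasurable_id.add hh)
    rw [expectedUtility_add X' hY']
    have h1 := integral_map hX (f := fun v => U (v + h v)) hmeas.aestronglyMeasurable
    have h2 := integral_map hX' (f := fun v => U (v + h v)) hmeas.aestronglyMeasurable
    change ∫ v, U (v + h v) ∂(law X) = _ at h1
    change ∫ v, U (v + h v) ∂(law X') = _ at h2
    rw [hlaw, h2] at h1
    exact hint.trans_eq h1.symm

end RiskMeasure

end SystemicRisk

theorem mainTheorem5 {Ω : Type*} [MeasurableSpace Ω] (P : Measure Ω) [IsProbabilityMeasure P]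
    (N : ℕ) (hN : 1 ≤ N) (U : (Fin N → ℝ) → ℝ)
    (hU_mono : Monotone U)
    (hU_diff : Differentiable ℝ U)
    (hU_conc : StrictConcaveOn ℝ univ U)
    (hU_sup : (0 : EReal) < ⨆ y : Fin N → ℝ, (U y : EReal))
    (hU_opt : SystemicRisk.SupConvAttained U) :
    SystemicRisk.FiniteValued (SystemicRisk.rho P U) ∧
      SystemicRisk.LawInvariant (SystemicRisk.rho P U) := by
  refine ⟨fun X => ?_, fun X Y hXY => le_antisymm ?_ ?_⟩
  · obtain ⟨y, hy⟩ := lt_iSup_iff.1 hU_sup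
    obtain ⟨a, b, hb, hle⟩ :=
      SystemicRisk.exists_le_add_mul_sum hN hU_mono hU_diff hU_conc hU_opt
    obtain ⟨c, hc⟩ := SystemicRisk.exists_rho_le hU_mono (by exact_mod_cast hy) X
    obtain ⟨d, hd⟩ := SystemicRisk.exists_le_rho hU_diff.continuous hb hle X
    refine ⟨(SystemicRisk.rho P U X).toReal, (EReal.coe_toReal ?_ ?_).symm⟩
    · exact (hc.trans_lt (EReal.coe_lt_top c)).ne
    · exact ((EReal.bot_lt_coe d).trans_le hd).ne'
  · exact SystemicRisk.rho_le_of_law_eq hU_conc.concaveOn hU_diff.continuous hXY.symm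
  · exact SystemicRisk.rho_le_of_law_eq hU_conc.concaveOn hU_diff.continuous hXY
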